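/- Let $X$ be a countably infinite set, $m:X\to(0,\infty)$, and $m(A)=\sum_{x\in A}m(x)$ for $A\subseteq X$. Let $b:X\times X\to[0,\infty)$ be symmetric with zero diagonal, with $\sum_{y}b(x,y)<\infty$ for every $x\in X$, and such that every $x$ has some $y$ with $b(x,y)>0$. Let $d$ be a pseudo metric on $X$ that is intrinsic, i.e. $\sum_{y\in X}b(x,y)d(x,y)^2\le m(x)$ for all $x\in X$. For $W\subseteq X$ put $\partial W=\{(x,y)\in W\times (X\setminus W): b(x,y)>0\}$ and $|\partial W|=\sum_{(x,y)\in\partial W}b(x,y)d(x,y)$. For $U\subseteq X$ let $$\alpha(U)=\inf\Big\{\frac{|\partial W|}{m(W)} : \emptyset\ne W\subseteq U \text{ finite}\Big\},\qquad \alpha_\infty=\sup_{K\subseteq X\text{ finite}}\alpha(X\setminus K)\in[0,\infty].$$ Let $C_c(X)$ be the space of finitely supported functions $X\to\mathbb R$, and let $\ell^2(X,m)$ be the real Hilbert space with inner product $\langle u,v\rangle=\sum_x u(x)v(x)m(x)$ and norm $\|\cdot\|$. Let $Q(u,v)=\frac12\sum_{x,y}b(x,y)(u(x)-u(y))(v(x)-v(y))$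 and $Q(u)=Q(u,u)$, with domain $D$ the closure of $C_c(X)$ in $\ell^2(X,m)$ with respect to $\|u\|_Q=(Q(u)+\|u\|^2)^{1/2}$. Let $L$ be the positive selfadjoint operator on $\ell^2(X,m)$ associated with $Q$: $u\in D(L)$ and $Lu=f$ if and only if $u\in D$ and $Q(u,v)=\langle f,v\rangle$ for all $v\in D$. Let $\sigma_{\mathrm{ess}}(L)$ be the essential spectrum, i.e. the spectrum of $L$ without the isolated points of the spectrum that are eigenvalues of finite multiplicity, and let $\lambda_0^{\mathrm{ess}}(L)=\inf\sigma_{\mathrm{ess}}(L)$ (with $\inf\emptyset=\infty$). Assume $C_c(X)\subseteq D(L)$. Then $$\lambda_0^{\mathrm{ess}}(L)\ \ge\ \frac{\alpha_\infty^2}{2}.$$ In particular, if $\alpha_\infty=\infty$, then $\sigma_{\mathrm{ess}}(L)=\emptyset$. -/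

import Mathlib

open MeasureTheory
open scoped ENNReal

noncomputable section

/-- A graph `b` over a discrete measure space `(X, m)`, without isolated vertices. -/
structure WeightedGraph (X : Type*) where
  /-- the vertex weight -/
  m : X → ℝ
  /-- the edge weight -/
  b : X → X → ℝ
  m_pos : ∀ x, 0 < m x
  b_nonneg : ∀ x y, 0 ≤ b x y
  b_symm : ∀ x y, b x y = b y x
  b_diag : ∀ x, b x x = 0
  b_summable : ∀ x, Summable (b x)
  no_isolated : ∀ x, ∃ y, 0 < b x y

namespace WeightedGraph

variable {X : Type*} (G : WeightedGraph X)

section Isoperimetric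

/-- The (pseudo) metric `dist` is intrinsic: `∑_y b(x,y) d(x,y)² ≤ m(x)` for all `x`. The sum is
taken in `[0,∞]`. -/
def IsIntrinsic [PseudoMetricSpace X] : Prop :=
  ∀ x, ∑' y, ENNReal.ofReal (G.b x y * dist x y ^ 2) ≤ ENNReal.ofReal (G.m x)

/-- The edge boundary of `W`. -/
def boundary (W : Set X) : Set (X × X) :=
  {p | p.1 ∈ W ∧ p.2 ∉ W ∧ 0 < G.b p.1 p.2}

/-- `|∂W| = ∑_{(x,y) ∈ ∂W} b(x,y) d(x,y)`, with values in `[0,∞]`. -/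
def boundaryMeasure [PseudoMetricSpace X] (W : Set X) : ℝ≥0∞ :=
  ∑' p : G.boundary W, ENNReal.ofReal (G.b p.1.1 p.1.2 * dist p.1.1 p.1.2)

/-- The isoperimetric constant `α(U) = inf |∂W| / m(W)`, over nonempty finite `W ⊆ U`. -/
def cheeger [PseudoMetricSpace X] (U : Set X) : ℝ≥0∞ :=
  ⨅ (W : Finset X) (_ : W.Nonempty) (_ : (W : Set X) ⊆ U),
    G.boundaryMeasure (W : Set X) / ENNReal.ofReal (∑ x ∈ W, G.m x)

/-- The isoperimetric constant at infinity `α_∞ = sup_K α(X ∖ K)`, over finite `K`. -/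
def cheegerInfty [PseudoMetricSpace X] : ℝ≥0∞ :=
  ⨆ K : Finset X, G.cheeger ((K : Set X)ᶜ)

end Isoperimetric

section Energy

/-- The energy `Q(u) = ½ ∑_{x,y} b(x,y) (u(x) - u(y))²`, with values in `[0,∞]`. -/
def energy (u : X → ℝ) : ℝ≥0∞ :=
  (1 / 2) * ∑' p : X × X, ENNReal.ofReal (G.b p.1 p.2 * (u p.1 - u p.2) ^ 2)

/-- The bilinear form `Q(u,v) = ½ ∑_{x,y} b(x,y) (u(x) - u(y)) (v(x) - v(y))`. The series converges
absolutely for `u, v` in the form domain, see `summable_of_mem`. -/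
def form (u v : X → ℝ) : ℝ :=
  (1 / 2) * ∑' p : X × X, G.b p.1 p.2 * ((u p.1 - u p.2) * (v p.1 - v p.2))

lemma energy_add_le (u v : X → ℝ) :
    G.energy (u + v) ≤ 2 * (G.energy u + G.energy v) := by
  have h : ∀ p : X × X, ENNReal.ofReal (G.b p.1 p.2 * ((u + v) p.1 - (u + v) p.2) ^ 2) ≤
      2 * (ENNReal.ofReal (G.b p.1 p.2 * (u p.1 - u p.2) ^ 2) +
        ENNReal.ofReal (G.b p.1 p.2 * (v p.1 - v p.2) ^ 2)) := by
    intro p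
    have hb := G.b_nonneg p.1 p.2
    rw [← ENNReal.ofReal_add (by positivity) (by positivity),
      show (2 : ℝ≥0∞) = ENNReal.ofReal 2 by simp, ← ENNReal.ofReal_mul (by norm_num)]
    refine ENNReal.ofReal_le_ofReal ?_
    simp only [Pi.add_apply]
    nlinarith [mul_nonneg hb (sq_nonneg ((u p.1 - u p.2) - (v p.1 - v p.2)))]
  calc G.energy (u + v) ≤ (1 / 2) * ∑' p : X × X,
        2 * (ENNReal.ofReal (G.b p.1 p.2 * (u p.1 - u p.2) ^ 2) +
          ENNReal.ofReal (G.b p.1 p.2 * (v p.1 - v p.2) ^ 2)) :=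
        mul_le_mul_right (ENNReal.tsum_le_tsum h) _
    _ = 2 * (G.energy u + G.energy v) := by
        rw [ENNReal.tsum_mul_left, ENNReal.tsum_add]
        unfold energy
        ring

lemma energy_smul (c : ℝ) (u : X → ℝ) : G.energy (c • u) = ‖c‖ₑ ^ 2 * G.energy u := by
  have h : ∀ p : X × X, ENNReal.ofReal (G.b p.1 p.2 * ((c • u) p.1 - (c • u) p.2) ^ 2) =
      ‖c‖ₑ ^ 2 * ENNReal.ofReal (G.b p.1 p.2 * (u p.1 - u p.2) ^ 2) := by
    intro p
    rw [Real.enorm_eq_ofReal_abs, ← ENNReal.ofReal_pow (abs_nonneg c), sq_abs,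
      ← ENNReal.ofReal_mul (sq_nonneg c)]
    congr 1
    simp only [Pi.smul_apply, smul_eq_mul]
    ring
  unfold energy
  rw [tsum_congr h, ENNReal.tsum_mul_left]
  ring

lemma energy_ne_top_of_finite {u : X → ℝ} (hu : (Function.support u).Finite) :
    G.energy u ≠ ∞ := by
  have hS : ∀ f : X → ℝ≥0∞, (∀ x, f x ≠ ∞) → (∀ x, u x = 0 → f x = 0) → ∑' x, f x ≠ ∞ := by
    intro f hf h0
    rw [tsum_eq_sum (s := hu.toFinset) (fun x hx => h0 x (by simpa using hx))]
    exact ENNReal.sum_ne_top.2 fun x _ => hf x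
  have hle : ∀ p : X × X, ENNReal.ofReal (G.b p.1 p.2 * (u p.1 - u p.2) ^ 2) ≤
      ENNReal.ofReal (2 * u p.1 ^ 2 * G.b p.1 p.2) +
        ENNReal.ofReal (2 * u p.2 ^ 2 * G.b p.2 p.1) := by
    intro p
    have hb := G.b_nonneg p.1 p.2
    rw [G.b_symm p.2 p.1, ← ENNReal.ofReal_add (by positivity) (by positivity)]
    refine ENNReal.ofReal_le_ofReal ?_
    nlinarith [mul_nonneg hb (sq_nonneg (u p.1 + u p.2))]
  have hone : ∑' x, ∑' y, ENNReal.ofReal (2 * u x ^ 2 * G.b x y) ≠ ∞ := by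
    refine hS _ (fun x => ?_) (fun x hx => by simp [hx])
    rw [← ENNReal.ofReal_tsum_of_nonneg (fun y => mul_nonneg (by positivity) (G.b_nonneg x y))
      ((G.b_summable x).mul_left _)]
    exact ENNReal.ofReal_ne_top
  have hsum : ∑' p : X × X, ENNReal.ofReal (G.b p.1 p.2 * (u p.1 - u p.2) ^ 2) ≠ ∞ := by
    refine ne_top_of_le_ne_top ?_ (ENNReal.tsum_le_tsum hle)
    rw [ENNReal.tsum_add]
    refine ENNReal.add_ne_top.2 ⟨?_, ?_⟩
    · rw [ENNReal.tsum_prod']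
      exact hone
    · rw [ENNReal.tsum_prod', ENNReal.tsum_comm]
      exact hone
  exact ENNReal.mul_ne_top (by simp) hsum

end Energy

section Laplacian

variable [MeasurableSpace X]

/-- The measure `m(A) = ∑_{x ∈ A} m(x)` on `X`. -/
def measure : Measure X :=
  Measure.sum fun x => ENNReal.ofReal (G.m x) • Measure.dirac x

/-- The real Hilbert space `ℓ²(X, m)`. -/
abbrev ell2 : Type _ := Lp ℝ 2 G.measure

/-- `C_c(X)` inside `ℓ²(X, m)`: for the discrete topology, the functions of finite support.
(As `m > 0`, an element of `ℓ²(X, m)` is one genuine function.) -/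
def Cc : Set G.ell2 := {u | (Function.support (u : X → ℝ)).Finite}

/-- The form norm `‖u‖_Q = (Q(u) + ‖u‖²)^{1/2}`, with values in `[0,∞]`. -/
def formNorm (u : G.ell2) : ℝ≥0∞ :=
  (G.energy u + ‖u‖ₑ ^ 2) ^ (1 / 2 : ℝ)

variable [DiscreteMeasurableSpace X]

lemma measure_singleton_ne_zero (x : X) : G.measure {x} ≠ 0 := by
  intro h
  rw [measure, Measure.sum_apply _ (MeasurableSet.of_discrete), ENNReal.tsum_eq_zero] at h
  have := h x
  simp at this
  exact absurd this (not_le.2 (G.m_pos x))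

lemma eq_of_ae {u v : X → ℝ} (h : u =ᵐ[G.measure] v) : u = v := by
  funext x
  by_contra hx
  exact G.measure_singleton_ne_zero x
    (measure_mono_null (by rintro y rfl; exact hx) (ae_iff.1 h))

lemma coe_add (u v : G.ell2) :
    ((u + v : G.ell2) : X → ℝ) = (u : X → ℝ) + v := G.eq_of_ae (Lp.coeFn_add u v)

lemma coe_sub (u v : G.ell2) :
    ((u - v : G.ell2) : X → ℝ) = (u : X → ℝ) - v := G.eq_of_ae (Lp.coeFn_sub u v)

lemma coe_smul (c : ℝ) (u : G.ell2) :
    ((c • u : G.ell2) : X → ℝ) = c • (u : X → ℝ) := G.eq_of_ae (Lp.coeFn_smul c u)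

lemma coe_zero : ((0 : G.ell2) : X → ℝ) = 0 :=
  G.eq_of_ae (Lp.coeFn_zero _ _ _)

lemma formNorm_add_le (u v : G.ell2) :
    G.formNorm (u + v) ≤ 2 * (G.formNorm u + G.formNorm v) := by
  have hsq : ∀ w : G.ell2, G.formNorm w ^ 2 = G.energy w + ‖w‖ₑ ^ 2 := by
    intro w
    rw [formNorm, ← ENNReal.rpow_natCast, ← ENNReal.rpow_mul]
    norm_num
  have key : G.formNorm (u + v) ^ 2 ≤ (2 * (G.formNorm u + G.formNorm v)) ^ 2 := by
    have h1 : G.energy ((u + v : G.ell2) : X → ℝ) ≤ 2 * (G.energy u + G.energy v) := by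
      rw [coe_add]
      exact G.energy_add_le u v
    have h2 : ‖u + v‖ₑ ^ 2 ≤ 2 * (‖u‖ₑ ^ 2 + ‖v‖ₑ ^ 2) := by
      refine (pow_le_pow_left' (enorm_add_le u v) 2).trans ?_
      have := ENNReal.rpow_add_le_mul_rpow_add_rpow ‖u‖ₑ ‖v‖ₑ (p := 2) (by norm_num)
      norm_num at this
      exact_mod_cast this
    calc G.formNorm (u + v) ^ 2
        ≤ 2 * (G.energy u + G.energy v) + 2 * (‖u‖ₑ ^ 2 + ‖v‖ₑ ^ 2) := by
          rw [hsq]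
          exact add_le_add h1 h2
      _ = 2 * (G.formNorm u ^ 2 + G.formNorm v ^ 2) := by
          rw [hsq, hsq]
          ring
      _ ≤ 2 * (G.formNorm u ^ 2 + G.formNorm v ^ 2) +
          (2 * (G.formNorm u ^ 2 + G.formNorm v ^ 2) + 8 * G.formNorm u * G.formNorm v) :=
          le_self_add
      _ = (2 * (G.formNorm u + G.formNorm v)) ^ 2 := by ring
  exact (ENNReal.pow_le_pow_left_iff two_ne_zero).1 key

lemma formNorm_smul (c : ℝ) (u : G.ell2) : G.formNorm (c • u) = ‖c‖ₑ * G.formNorm u := by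
  unfold formNorm
  rw [coe_smul, energy_smul, enorm_smul, mul_pow, ← mul_add,
    ENNReal.mul_rpow_of_nonneg _ _ (by norm_num), ← ENNReal.rpow_natCast, ← ENNReal.rpow_mul]
  norm_num

lemma formNorm_zero : G.formNorm 0 = 0 := by
  have := G.formNorm_smul 0 0
  simpa using this

lemma add_mem_Cc {u v : G.ell2} (hu : u ∈ G.Cc) (hv : v ∈ G.Cc) : u + v ∈ G.Cc := by
  simp only [Cc, Set.mem_ofPred_eq, coe_add] at *
  exact (hu.union hv).subset (Function.support_add _ _)

lemma smul_mem_Cc (c : ℝ) {u : G.ell2} (hu : u ∈ G.Cc) : c • u ∈ G.Cc := by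
  simp only [Cc, Set.mem_ofPred_eq, coe_smul] at *
  exact hu.subset (Function.support_const_smul_subset c _)

lemma zero_mem_Cc : (0 : G.ell2) ∈ G.Cc := by
  simp only [Cc, Set.mem_ofPred_eq]
  rw [G.coe_zero]
  simp

/-- The form domain `D`: the closure of `C_c(X)` with respect to `‖·‖_Q`. -/
def formDomain : Submodule ℝ G.ell2 where
  carrier := {u | ∀ ε : ℝ≥0∞, 0 < ε → ∃ φ ∈ G.Cc, G.formNorm (u - φ) < ε}
  zero_mem' := fun ε hε => ⟨0, G.zero_mem_Cc, by rwa [sub_zero, formNorm_zero]⟩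
  add_mem' := by
    intro u v hu hv ε hε
    have h4 : 0 < ε / 4 := ENNReal.div_pos hε.ne' (by norm_num)
    obtain ⟨φ, hφ, h1⟩ := hu (ε / 4) h4
    obtain ⟨ψ, hψ, h2⟩ := hv (ε / 4) h4
    refine ⟨φ + ψ, G.add_mem_Cc hφ hψ, ?_⟩
    rw [add_sub_add_comm]
    refine (G.formNorm_add_le _ _).trans_lt ?_
    calc 2 * (G.formNorm (u - φ) + G.formNorm (v - ψ)) < 2 * (ε / 4 + ε / 4) :=
          (ENNReal.mul_lt_mul_iff_right (by norm_num) (by norm_num)).2 (ENNReal.add_lt_add h1 h2)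
      _ = ε := by
          rw [← two_mul, ← mul_assoc, mul_comm]
          norm_num
          exact ENNReal.div_mul_cancel (by norm_num) (by norm_num)
  smul_mem' := by
    intro c u hu ε hε
    by_cases hc : c = 0
    · exact ⟨0, G.zero_mem_Cc, by simpa [hc, formNorm_zero] using hε⟩
    · have hc' : ‖c‖ₑ ≠ 0 := by simpa using hc
      obtain ⟨φ, hφ, h⟩ := hu (ε / ‖c‖ₑ) (ENNReal.div_pos hε.ne' (by simp))
      refine ⟨c • φ, G.smul_mem_Cc c hφ, ?_⟩
      rw [← smul_sub, formNorm_smul, mul_comm]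
      exact (ENNReal.lt_div_iff_mul_lt (Or.inl hc') (Or.inl (by simp))).1 h

lemma Cc_subset_formDomain : G.Cc ⊆ G.formDomain :=
  fun u hu ε hε => ⟨u, hu, by rwa [sub_self, formNorm_zero]⟩

lemma energy_ne_top_of_mem {u : G.ell2} (hu : u ∈ G.formDomain) : G.energy u ≠ ∞ := by
  obtain ⟨φ, hφ, h⟩ := hu 1 one_pos
  have h1 : G.energy ((u - φ : G.ell2) : X → ℝ) ≠ ∞ := by
    intro htop
    rw [formNorm, htop] at h
    norm_num at h
  have h2 : (u : X → ℝ) = ((u - φ : G.ell2) : X → ℝ) + φ := by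
    rw [← coe_add, sub_add_cancel]
  rw [h2]
  exact ne_top_of_le_ne_top
    (ENNReal.mul_ne_top (by norm_num) (ENNReal.add_ne_top.2 ⟨h1, G.energy_ne_top_of_finite hφ⟩))
    (G.energy_add_le _ _)

lemma summable_sq_of_mem {u : G.ell2} (hu : u ∈ G.formDomain) :
    Summable fun p : X × X => G.b p.1 p.2 * (u p.1 - u p.2) ^ 2 := by
  have h : ∑' p : X × X, ENNReal.ofReal (G.b p.1 p.2 * (u p.1 - u p.2) ^ 2) ≠ ∞ := by
    intro htop
    exact G.energy_ne_top_of_mem hu (by simp [energy, htop])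
  have h' := ENNReal.summable_toReal h
  refine h'.congr fun p => ?_
  rw [ENNReal.toReal_ofReal (mul_nonneg (G.b_nonneg _ _) (sq_nonneg _))]

lemma summable_of_mem {u v : G.ell2} (hu : u ∈ G.formDomain) (hv : v ∈ G.formDomain) :
    Summable fun p : X × X => G.b p.1 p.2 * ((u p.1 - u p.2) * (v p.1 - v p.2)) := by
  refine Summable.of_norm_bounded ((G.summable_sq_of_mem hu).add (G.summable_sq_of_mem hv)) ?_
  intro p
  have hb := G.b_nonneg p.1 p.2
  rw [Real.norm_eq_abs, abs_le]
  constructor <;>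
    nlinarith [mul_nonneg hb (sq_nonneg ((u p.1 - u p.2) + (v p.1 - v p.2))),
      mul_nonneg hb (sq_nonneg ((u p.1 - u p.2) - (v p.1 - v p.2))),
      mul_nonneg hb (sq_nonneg (u p.1 - u p.2)), mul_nonneg hb (sq_nonneg (v p.1 - v p.2))]

/-- The graph of the operator `L` of the form `Q`: `u ∈ D(L)` and `L u = f` if and only if `u ∈ D`
and `Q(u,v) = ⟨f,v⟩` for all `v ∈ D`. -/
def laplacianGraph : Submodule ℝ (G.ell2 × G.ell2) where
  carrier := {p | p.1 ∈ G.formDomain ∧ ∀ v ∈ G.formDomain, G.form p.1 v = inner ℝ p.2 v}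
  zero_mem' := ⟨zero_mem _, fun v _ => by
    rw [Prod.fst_zero, Prod.snd_zero, G.coe_zero, inner_zero_left]
    simp [form]⟩
  add_mem' := by
    rintro ⟨u, f⟩ ⟨u', f'⟩ ⟨hu, h⟩ ⟨hu', h'⟩
    refine ⟨add_mem hu hu', fun v hv => ?_⟩
    have e := h v hv
    have e' := h' v hv
    simp only [Prod.fst_add, Prod.snd_add] at *
    rw [inner_add_left, ← e, ← e', form, form, form, coe_add, ← mul_add,
      ← (G.summable_of_mem hu hv).tsum_add (G.summable_of_mem hu' hv)]
    congr 1
    refine tsum_congr fun p => ?_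
    simp only [Pi.add_apply]
    ring
  smul_mem' := by
    rintro c ⟨u, f⟩ ⟨hu, h⟩
    refine ⟨Submodule.smul_mem _ c hu, fun v hv => ?_⟩
    have e := h v hv
    simp only [Prod.smul_fst, Prod.smul_snd] at *
    rw [real_inner_smul_left, ← e, form, form, coe_smul, mul_left_comm]
    congr 1
    rw [← tsum_mul_left]
    refine tsum_congr fun p => ?_
    simp only [Pi.smul_apply, smul_eq_mul]
    ring

lemma measure_singleton_ne_top (x : X) : G.measure {x} ≠ ∞ := by
  rw [measure, Measure.sum_apply _ (MeasurableSet.of_discrete)]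
  rw [tsum_eq_single x]
  · simp
  · intro y hy
    simp [hy]

/-- The relation `laplacianGraph` is single valued, as `C_c(X)` is dense. -/
lemma laplacianGraph_single_valued (p : G.ell2 × G.ell2) (hp : p ∈ G.laplacianGraph)
    (h0 : p.1 = 0) : p.2 = 0 := by
  obtain ⟨u, f⟩ := p
  obtain ⟨-, h⟩ := hp
  simp only at h h0 ⊢
  subst h0
  have hf : (f : X → ℝ) = 0 := by
    funext x
    have hx := G.measure_singleton_ne_top x
    set v : G.ell2 := indicatorConstLp 2 (MeasurableSet.of_discrete (s := {x})) hx (1 : ℝ) with hv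
    have hvc : (v : X → ℝ) = Set.indicator {x} fun _ => (1 : ℝ) := G.eq_of_ae indicatorConstLp_coeFn
    have hvm : v ∈ G.Cc := by
      simp only [Cc, Set.mem_ofPred_eq, hvc]
      exact (Set.finite_singleton x).subset Set.support_indicator_subset
    have e := h v (G.Cc_subset_formDomain hvm)
    rw [real_inner_comm, hv, L2.inner_indicatorConstLp_one] at e
    simp only [form, coe_zero, Pi.zero_apply, sub_self, zero_mul, mul_zero, tsum_zero,
      integral_singleton, smul_eq_mul] at e
    have hpos : G.measure.real {x} ≠ 0 :=
      ENNReal.toReal_ne_zero.2 ⟨G.measure_singleton_ne_zero x, hx⟩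
    simpa [hpos] using e.symm
  refine Lp.ext ?_
  rw [hf, G.coe_zero]

/-- The Laplacian `L`: the (unbounded) operator on `ℓ²(X, m)` associated with the form `Q` on `D`. -/
def laplacian : G.ell2 →ₗ.[ℝ] G.ell2 := G.laplacianGraph.toLinearPMap

lemma graph_laplacian : G.laplacian.graph = G.laplacianGraph :=
  Submodule.toLinearPMap_graph_eq _ G.laplacianGraph_single_valued

end Laplacian

end WeightedGraph

namespace LinearPMap

variable {E : Type*} [NormedAddCommGroup E] [NormedSpace ℝ E] (A : E →ₗ.[ℝ] E)

/-- `A - μ` on the domain of `A`. -/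
def subScalar (μ : ℝ) : A.domain →ₗ[ℝ] E := A.toFun - μ • A.domain.subtype

/-- `μ` is in the resolvent set: `A - μ` maps the domain of `A` bijectively onto `E`, with bounded
inverse. -/
def realResolventSet : Set ℝ :=
  {μ | Function.Bijective (A.subScalar μ) ∧ ∃ C : ℝ, ∀ u : A.domain, ‖u‖ ≤ C * ‖A.subScalar μ u‖}

/-- The spectrum (all of it is real for a selfadjoint operator). -/
def realSpectrum : Set ℝ := A.realResolventSetᶜ

/-- The discrete spectrum: the isolated points of the spectrum that are eigenvalues of finite
multiplicity. -/
def discreteSpectrum : Set ℝ :=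
  {μ | μ ∈ A.realSpectrum ∧ (∃ ε > 0, ∀ ν ∈ A.realSpectrum, |ν - μ| < ε → ν = μ) ∧
    LinearMap.ker (A.subScalar μ) ≠ ⊥ ∧ FiniteDimensional ℝ (LinearMap.ker (A.subScalar μ))}

/-- The essential spectrum (of a selfadjoint operator). -/
def essentialSpectrum : Set ℝ := A.realSpectrum \ A.discreteSpectrum

/-- The bottom of the essential spectrum, in `[-∞,∞]`; it is `∞` if the essential spectrum is
empty. -/
def bottomEssentialSpectrum : EReal := ⨅ μ ∈ A.essentialSpectrum, (μ : EReal)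

end LinearPMap

end

/-!
The proof compares the form `Q` with the norm of `ℓ²(X, m)` outside a finite set `K`, and uses that
functions vanishing on `K` have finite codimension in the form domain.

Let `a ≤ α(X ∖ K)`. For a finitely supported `φ` that vanishes on `K`, the coarea formula
(`cheeger_mul_tsum_le`) applied to `φ²` gives `2 a ‖φ‖² ≤ ∑ b d |φ(x)² - φ(y)²|`, and the
arithmetic-geometric mean inequality together with `∑_y b d² ≤ m` bounds the right-hand side by
`(2 / a) Q(φ) + a ‖φ‖²`. Hence `a² / 2 ‖φ‖² ≤ Q(φ)` (`mul_tsum_sq_le_energy`). By density of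
`C_c(X)` this extends to all elements of the form domain that vanish on `K` (`one_add_mul_norm_sq_le`).

The form domain with inner product `⟨u, v⟩ + Q(u, v)` is a Hilbert space `H` (`formSpace`), and
`L u - ν u = f` is the equation `⟨z, w⟩_H - (1 + ν) ⟨J z, J w⟩ = ⟨f, J w⟩` for all `w`, with
`J : H → ℓ²(X, m)` the inclusion. Let `ν < a² / 2`. The form on the left is coercive on a
subspace of finite codimension. So it is represented by a selfadjoint operator of closed range, and
if that operator is injective, it is invertible and `ν` is in the resolvent set
(`exists_weak_solution`). On the other hand, on the span of eigenvectors with eigenvalues below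
`a² / 2` one has `Q < a² / 2 ‖·‖²`, so no nonzero element of it vanishes on `K`: there are at most
`|K|` such eigenvalues (`card_le_finrank_of_isWeakEigenvector`), all of finite multiplicity.
Therefore the spectrum below `a² / 2` is discrete (`mem_discreteSpectrum`), and the bound follows
upon taking the supremum over `a` and `K`.
-/

/-! ### The isoperimetric inequality for finitely supported functions -/

lemma setLIntegral_Ici_indicator_Ico {a : ℝ} (ha : 0 ≤ a) (c : ℝ) :
    ∫⁻ t in Set.Ici (0 : ℝ), (Set.Ico a c).indicator 1 t = ENNReal.ofReal (c - a) := by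
  rw [lintegral_indicator_one measurableSet_Ico, Measure.restrict_apply measurableSet_Ico,
    Set.inter_eq_left.2 (show Set.Ico a c ⊆ Set.Ici 0 from fun t ht => ha.trans ht.1),
    Real.volume_Ico]

namespace WeightedGraph

variable {X : Type*} (G : WeightedGraph X)

lemma cheeger_mul_le [PseudoMetricSpace X] {U : Set X} {W : Finset X} (hW : (W : Set X) ⊆ U) :
    G.cheeger U * ENNReal.ofReal (∑ x ∈ W, G.m x) ≤ G.boundaryMeasure (W : Set X) := by
  rcases W.eq_empty_or_nonempty with rfl | hne
  · simp
  · have hpos : 0 < ∑ x ∈ W, G.m x := Finset.sum_pos (fun x _ => G.m_pos x) hne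
    calc G.cheeger U * ENNReal.ofReal (∑ x ∈ W, G.m x)
        ≤ G.boundaryMeasure (W : Set X) / ENNReal.ofReal (∑ x ∈ W, G.m x) *
            ENNReal.ofReal (∑ x ∈ W, G.m x) :=
          mul_le_mul_left (iInf₂_le_of_le W hne (iInf_le _ hW)) _
      _ = G.boundaryMeasure (W : Set X) :=
          ENNReal.div_mul_cancel (by simpa using hpos) ENNReal.ofReal_ne_top

/-- The boundary measure of a superlevel set, as a sum over all pairs: the pair `(x, y)`
contributes at the levels `t` with `f y ≤ t < f x`. -/
lemma boundaryMeasure_superlevel [PseudoMetricSpace X] (f : X → ℝ) (t : ℝ) :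
    G.boundaryMeasure {x | t < f x} = ∑' p : X × X,
      ENNReal.ofReal (G.b p.1 p.2 * dist p.1 p.2) * (Set.Ico (f p.2) (f p.1)).indicator 1 t := by
  rw [boundaryMeasure, tsum_subtype (G.boundary {x | t < f x})
    fun p => ENNReal.ofReal (G.b p.1 p.2 * dist p.1 p.2)]
  refine tsum_congr fun p => ?_
  rcases (G.b_nonneg p.1 p.2).eq_or_lt with hb | hb
  · simp [Set.indicator_apply, ← hb]
  · by_cases h : f p.2 ≤ t ∧ t < f p.1
    · rw [Set.indicator_of_mem, Set.indicator_of_mem (Set.mem_Ico.2 h)]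
      · simp
      · exact ⟨h.2, by simpa using h.1, hb⟩
    · rw [Set.indicator_of_notMem, Set.indicator_of_notMem (by simpa using h), mul_zero]
      rintro ⟨h1, h2, -⟩
      exact h ⟨by simpa using h2, h1⟩

/-- The coarea estimate. As `ENNReal.ofReal` truncates, the right-hand side is the sum of the
positive parts of the differences; it is the integral of `|∂{f > t}|` over the levels `t ≥ 0`. -/
lemma cheeger_mul_tsum_le [Countable X] [PseudoMetricSpace X] {U : Set X} {f : X → ℝ}
    (hf : 0 ≤ f) (hfin : (Function.support f).Finite) (hU : Function.support f ⊆ U) :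
    G.cheeger U * ∑' x, ENNReal.ofReal (G.m x * f x) ≤
      ∑' p : X × X, ENNReal.ofReal (G.b p.1 p.2 * dist p.1 p.2 * (f p.1 - f p.2)) := by
  have hmeas : ∀ a c : ℝ, Measurable ((Set.Ico a c).indicator (1 : ℝ → ℝ≥0∞)) :=
    fun a c => measurable_one.indicator measurableSet_Ico
  have hR : ∑' p : X × X, ENNReal.ofReal (G.b p.1 p.2 * dist p.1 p.2 * (f p.1 - f p.2)) =
      ∫⁻ t in Set.Ici (0 : ℝ), G.boundaryMeasure {x | t < f x} := by
    simp_rw [boundaryMeasure_superlevel]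
    rw [lintegral_tsum fun p => ((hmeas _ _).const_mul _).aemeasurable]
    refine tsum_congr fun p => ?_
    rw [lintegral_const_mul _ (hmeas _ _), setLIntegral_Ici_indicator_Ico (hf _),
      ENNReal.ofReal_mul (mul_nonneg (G.b_nonneg _ _) dist_nonneg)]
  have hL : ∑' x, ENNReal.ofReal (G.m x * f x) = ∫⁻ t in Set.Ici (0 : ℝ),
      ∑' x, ENNReal.ofReal (G.m x) * (Set.Ico 0 (f x)).indicator 1 t := by
    rw [lintegral_tsum fun p => ((hmeas _ _).const_mul _).aemeasurable]
    refine tsum_congr fun x => ?_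
    rw [lintegral_const_mul _ (hmeas _ _), setLIntegral_Ici_indicator_Ico le_rfl,
      ENNReal.ofReal_mul (G.m_pos x).le, sub_zero]
  have hm : Measurable fun t => ∑' x, ENNReal.ofReal (G.m x) * (Set.Ico 0 (f x)).indicator 1 t :=
    Measurable.tsum fun x => (hmeas _ _).const_mul _
  rw [hR, hL, ← lintegral_const_mul _ hm]
  refine setLIntegral_mono' measurableSet_Ici fun t ht => ?_
  have ht : 0 ≤ t := ht
  have hs : {x | t < f x} ⊆ Function.support f := fun x hx => (ht.trans_lt hx).ne'
  have hW : ((hfin.subset hs).toFinset : Set X) = {x | t < f x} := by simp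
  have key := G.cheeger_mul_le (U := U) (W := (hfin.subset hs).toFinset) (by
    rw [hW]
    exact hs.trans hU)
  rw [hW] at key
  refine le_trans (le_of_eq ?_) key
  congr 1
  rw [ENNReal.ofReal_sum_of_nonneg fun x _ => (G.m_pos x).le,
    tsum_eq_sum (s := (hfin.subset hs).toFinset)]
  · refine Finset.sum_congr rfl fun x hx => ?_
    rw [Set.indicator_of_mem (show t ∈ Set.Ico 0 (f x) from ⟨ht, by simpa using hx⟩)]
    simp
  · intro x hx
    rw [Set.indicator_of_notMem (fun h => hx (by simpa using h.2)), mul_zero]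

/-- Cheeger's inequality: `a² / 2 ‖φ‖² ≤ Q(φ)` for finitely supported `φ` that vanish outside a
set `U` of isoperimetric constant at least `a`. -/
lemma mul_tsum_sq_le_energy [Countable X] [PseudoMetricSpace X] (hd : G.IsIntrinsic) {U : Set X}
    {a : ℝ} (ha : 0 ≤ a) (haU : ENNReal.ofReal a ≤ G.cheeger U) {φ : X → ℝ}
    (hfin : (Function.support φ).Finite) (hU : Function.support φ ⊆ U) :
    ENNReal.ofReal (a ^ 2 / 2) * ∑' x, ENNReal.ofReal (G.m x * φ x ^ 2) ≤ G.energy φ := by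
  rcases ha.eq_or_lt with rfl | ha
  · simp
  set N := ∑' x, ENNReal.ofReal (G.m x * φ x ^ 2) with hN
  have hNtop : N ≠ ∞ := by
    rw [hN, tsum_eq_sum (s := hfin.toFinset) (fun x hx => by simp_all)]
    exact ENNReal.sum_ne_top.2 fun _ _ => ENNReal.ofReal_ne_top
  set E := ∑' p : X × X, ENNReal.ofReal (G.b p.1 p.2 * (φ p.1 - φ p.2) ^ 2) with hE
  set S := ∑' p : X × X,
    ENNReal.ofReal (G.b p.1 p.2 * dist p.1 p.2 * (φ p.1 ^ 2 - φ p.2 ^ 2)) with hS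
  have hS' : S = ∑' p : X × X,
      ENNReal.ofReal (G.b p.1 p.2 * dist p.1 p.2 * (φ p.2 ^ 2 - φ p.1 ^ 2)) := by
    rw [hS, ← (Equiv.prodComm X X).tsum_eq]
    refine tsum_congr fun p => ?_
    simp only [Equiv.prodComm_apply, Prod.fst_swap, Prod.snd_swap]
    rw [G.b_symm, dist_comm]
  have hsupp : Function.support (fun x => φ x ^ 2) = Function.support φ := by
    ext x
    simp
  have h1 : ENNReal.ofReal a * N ≤ S :=
    (mul_le_mul_left haU _).trans
      (G.cheeger_mul_tsum_le (f := fun x => φ x ^ 2) (fun x => sq_nonneg _)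
        (by rwa [hsupp]) (by rwa [hsupp]))
  set D : X × X → ℝ≥0∞ := fun p => ENNReal.ofReal (G.b p.1 p.2 * dist p.1 p.2 ^ 2) with hD
  -- The weight `a` in the arithmetic-geometric mean inequality makes the mass terms on both
  -- sides differ by exactly `a N`.
  have hterm : ∀ p : X × X,
      ENNReal.ofReal (G.b p.1 p.2 * dist p.1 p.2 * (φ p.1 ^ 2 - φ p.2 ^ 2)) +
        ENNReal.ofReal (G.b p.1 p.2 * dist p.1 p.2 * (φ p.2 ^ 2 - φ p.1 ^ 2)) ≤
      ENNReal.ofReal (1 / a) * ENNReal.ofReal (G.b p.1 p.2 * (φ p.1 - φ p.2) ^ 2) +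
        ENNReal.ofReal (a / 2) * (ENNReal.ofReal (φ p.1 ^ 2) * D p +
          ENNReal.ofReal (φ p.2 ^ 2) * D p) := by
    intro p
    have hb := G.b_nonneg p.1 p.2
    have hc : 0 ≤ G.b p.1 p.2 * dist p.1 p.2 := mul_nonneg hb dist_nonneg
    have hreal : ∀ s t : ℝ, G.b p.1 p.2 * dist p.1 p.2 * (s ^ 2 - t ^ 2) ≤
        1 / a * (G.b p.1 p.2 * (s - t) ^ 2) + a / 2 *
          (s ^ 2 * (G.b p.1 p.2 * dist p.1 p.2 ^ 2) +
            t ^ 2 * (G.b p.1 p.2 * dist p.1 p.2 ^ 2)) := by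
      intro s t
      have key : dist p.1 p.2 * (s ^ 2 - t ^ 2) ≤ 1 / a * (s - t) ^ 2 +
          a / 2 * ((s ^ 2 + t ^ 2) * dist p.1 p.2 ^ 2) := by
        have e : 1 / a * (s - t) ^ 2 + a / 2 * ((s ^ 2 + t ^ 2) * dist p.1 p.2 ^ 2) -
            dist p.1 p.2 * (s ^ 2 - t ^ 2) =
            1 / a * ((s - t) - a / 2 * (dist p.1 p.2 * (s + t))) ^ 2 +
              a / 4 * (dist p.1 p.2 * (s - t)) ^ 2 := by
          field_simp
          ring
        have : 0 ≤ 1 / a * ((s - t) - a / 2 * (dist p.1 p.2 * (s + t))) ^ 2 +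
              a / 4 * (dist p.1 p.2 * (s - t)) ^ 2 := by positivity
        linarith
      nlinarith [mul_le_mul_of_nonneg_left key hb]
    have hR : ENNReal.ofReal (1 / a) * ENNReal.ofReal (G.b p.1 p.2 * (φ p.1 - φ p.2) ^ 2) +
        ENNReal.ofReal (a / 2) * (ENNReal.ofReal (φ p.1 ^ 2) * D p +
          ENNReal.ofReal (φ p.2 ^ 2) * D p) =
        ENNReal.ofReal (1 / a * (G.b p.1 p.2 * (φ p.1 - φ p.2) ^ 2) + a / 2 *
          (φ p.1 ^ 2 * (G.b p.1 p.2 * dist p.1 p.2 ^ 2) +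
            φ p.2 ^ 2 * (G.b p.1 p.2 * dist p.1 p.2 ^ 2))) := by
      rw [hD, ← ENNReal.ofReal_mul (by positivity), ← ENNReal.ofReal_mul (by positivity),
        ← ENNReal.ofReal_mul (by positivity), ← ENNReal.ofReal_add (by positivity) (by positivity),
        ← ENNReal.ofReal_mul (by positivity), ← ENNReal.ofReal_add (by positivity) (by positivity)]
    rw [hR]
    rcases le_total (φ p.1 ^ 2) (φ p.2 ^ 2) with h | h
    · rw [ENNReal.ofReal_of_nonpos (mul_nonpos_of_nonneg_of_nonpos hc (sub_nonpos.2 h)), zero_add]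
      refine ENNReal.ofReal_le_ofReal ((hreal _ _).trans (le_of_eq ?_))
      ring
    · rw [ENNReal.ofReal_of_nonpos (p := _ * (φ p.2 ^ 2 - φ p.1 ^ 2))
        (mul_nonpos_of_nonneg_of_nonpos hc (sub_nonpos.2 h)), add_zero]
      exact ENNReal.ofReal_le_ofReal (hreal _ _)
  have hDN : ∑' p : X × X, ENNReal.ofReal (φ p.1 ^ 2) * D p ≤ N := by
    rw [ENNReal.tsum_prod']
    refine ENNReal.tsum_le_tsum fun x => ?_
    dsimp only
    rw [ENNReal.tsum_mul_left, mul_comm (G.m x), ENNReal.ofReal_mul (sq_nonneg _)]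
    exact mul_le_mul_right (hd x) _
  have hDN' : ∑' p : X × X, ENNReal.ofReal (φ p.2 ^ 2) * D p ≤ N := by
    rw [← (Equiv.prodComm X X).tsum_eq]
    refine le_trans (le_of_eq (tsum_congr fun p => ?_)) hDN
    simp only [hD, Equiv.prodComm_apply, Prod.fst_swap, Prod.snd_swap]
    rw [G.b_symm, dist_comm]
  have h2 : S + S ≤ ENNReal.ofReal (1 / a) * E + ENNReal.ofReal (a / 2) * (N + N) := by
    nth_rw 2 [hS']
    rw [hS, ← ENNReal.tsum_add]
    refine (ENNReal.tsum_le_tsum hterm).trans ?_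
    rw [ENNReal.tsum_add, ENNReal.tsum_mul_left, ENNReal.tsum_mul_left, ENNReal.tsum_add]
    gcongr
  have h3 : ENNReal.ofReal (a / 2) * (N + N) = ENNReal.ofReal a * N := by
    rw [← two_mul, ← mul_assoc, ← ENNReal.ofReal_ofNat 2, ← ENNReal.ofReal_mul (by positivity)]
    congr 2
    ring
  have h4 : ENNReal.ofReal a * N ≤ ENNReal.ofReal (1 / a) * E := by
    refine ENNReal.le_of_add_le_add_right (ENNReal.mul_ne_top ENNReal.ofReal_ne_top hNtop)
      ((add_le_add h1 h1).trans ?_)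
    exact h3 ▸ h2
  calc ENNReal.ofReal (a ^ 2 / 2) * N = ENNReal.ofReal (a / 2) * (ENNReal.ofReal a * N) := by
        rw [← mul_assoc, ← ENNReal.ofReal_mul (by positivity)]
        congr 2
        ring
    _ ≤ ENNReal.ofReal (a / 2) * (ENNReal.ofReal (1 / a) * E) := mul_le_mul_right h4 _
    _ = G.energy φ := by
        rw [← mul_assoc, ← ENNReal.ofReal_mul (by positivity), energy]
        congr 1
        rw [show a / 2 * (1 / a) = 2⁻¹ by field_simp, ENNReal.ofReal_inv_of_pos two_pos]
        simp

end WeightedGraph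

/-! ### Forms that are coercive on a subspace of finite codimension -/

section Pencil

variable {H E V : Type*} [NormedAddCommGroup H] [InnerProductSpace ℝ H]
  [NormedAddCommGroup E] [InnerProductSpace ℝ E]
  [AddCommGroup V] [Module ℝ V]

/-- A selfadjoint operator that is injective, and coercive on a closed subspace of finite
codimension, is an isomorphism: its range is closed, since the image of the subspace is, and dense,
since the orthogonal complement of the range is the kernel. -/
lemma exists_equiv_of_coercive_on [CompleteSpace H] (T : H →L[ℝ] H) (hT : IsSelfAdjoint T)
    (s : Submodule ℝ H) (hs : IsClosed (s : Set H)) [s.CoFG] {ε : ℝ} (hε : 0 < ε)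
    (hco : ∀ z ∈ s, ε * ‖z‖ ^ 2 ≤ inner ℝ (T z) z) (hinj : ∀ z, T z = 0 → z = 0) :
    ∃ e : H ≃L[ℝ] H, ∀ z, e z = T z := by
  have hbd : ∀ z : s, ‖z‖ ≤ (⟨ε⁻¹, by positivity⟩ : NNReal) * ‖T z‖ := by
    intro z
    have h1 := (hco z z.2).trans (real_inner_le_norm _ _)
    rcases (norm_nonneg (z : H)).eq_or_lt with h0 | h0
    · rw [Submodule.coe_norm, ← h0]
      positivity
    · have h2 : ε * ‖(z : H)‖ ≤ ‖T z‖ := le_of_mul_le_mul_right (by nlinarith) h0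
      rw [Submodule.coe_norm]
      change ‖(z : H)‖ ≤ ε⁻¹ * ‖T z‖
      rw [inv_mul_eq_div, le_div_iff₀ hε]
      linarith
  have hcl : IsClosed (s.map (T : H →ₗ[ℝ] H) : Set H) := by
    have hanti : AntilipschitzWith ⟨ε⁻¹, by positivity⟩ (T ∘L s.subtypeL) :=
      ContinuousLinearMap.antilipschitz_of_bound _ hbd
    have : CompleteSpace s := hs.completeSpace_coe
    have h := hanti.isClosed_range (T ∘L s.subtypeL).uniformContinuous
    convert h using 1
    ext y
    simp
  have hr : IsClosed ((T : H →ₗ[ℝ] H).range : Set H) :=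
    LinearMap.isClosed_range_of_isClosed_map_of_finiteDimensional_quotient hcl
  have hk : (T : H →ₗ[ℝ] H).ker = ⊥ := (Submodule.eq_bot_iff _).2 fun z hz => hinj z hz
  have : CompleteSpace (T : H →ₗ[ℝ] H).range := hr.completeSpace_coe
  have htop : (T : H →ₗ[ℝ] H).range = ⊤ := by
    rw [← Submodule.orthogonal_eq_bot_iff, ContinuousLinearMap.orthogonal_range,
      ContinuousLinearMap.isSelfAdjoint_iff'.1 hT, hk]
  exact ⟨ContinuousLinearEquiv.ofBijective T hk htop, fun z => rfl⟩

/-- `z` solves the eigenvalue equation `⟨z, w⟩ = κ ⟨J z, J w⟩`, for all `w`, of the pair of forms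
`⟨z, w⟩` and `⟨J z, J w⟩`. -/
def IsWeakEigenvector (J : H →L[ℝ] E) (κ : ℝ) (z : H) : Prop :=
  ∀ w, inner ℝ z w = κ * inner ℝ (J z) (J w)

lemma IsWeakEigenvector.norm_sq {J : H →L[ℝ] E} {κ : ℝ} {z : H}
    (hz : IsWeakEigenvector J κ z) : ‖z‖ ^ 2 = κ * ‖J z‖ ^ 2 := by
  rw [← real_inner_self_eq_norm_sq, ← real_inner_self_eq_norm_sq]
  exact hz z

lemma IsWeakEigenvector.inner_map_eq_zero {J : H →L[ℝ] E} {κ κ' : ℝ} {z z' : H}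
    (hz : IsWeakEigenvector J κ z) (hz' : IsWeakEigenvector J κ' z') (h : κ ≠ κ') :
    inner ℝ (J z) (J z') = 0 := by
  have h1 := hz z'
  have h2 := hz' z
  rw [real_inner_comm, real_inner_comm (J z)] at h2
  have h3 : (κ - κ') * inner ℝ (J z) (J z') = 0 := by linarith
  exact (mul_eq_zero.1 h3).resolve_left (sub_ne_zero.2 h)

variable {J : H →L[ℝ] E} {r : H →ₗ[ℝ] V} {κ₀ : ℝ}

lemma IsWeakEigenvector.eq_zero_of_map_eq_zero
    (hr : ∀ w, r w = 0 → κ₀ * ‖J w‖ ^ 2 ≤ ‖w‖ ^ 2) {κ : ℝ} (hκ : κ < κ₀) {z : H}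
    (hz : IsWeakEigenvector J κ z) (h0 : r z = 0) : z = 0 := by
  have h1 := hr z h0
  have h2 := hz.norm_sq
  have h3 : ‖J z‖ ^ 2 = 0 := by nlinarith [sq_nonneg ‖J z‖]
  rw [h3, mul_zero] at h2
  simpa using h2

/-- At most `dim V` numbers below `κ₀` are eigenvalues: on the span of the eigenvectors the form
`‖w‖² - κ₀ ‖J w‖²` is negative definite, so the span meets the kernel of `r` trivially. -/
lemma card_le_finrank_of_isWeakEigenvector [FiniteDimensional ℝ V]
    (hr : ∀ w, r w = 0 → κ₀ * ‖J w‖ ^ 2 ≤ ‖w‖ ^ 2) (t : Finset ℝ) (ht : ∀ κ ∈ t, κ < κ₀)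
    (z : t → H) (hz : ∀ κ : t, IsWeakEigenvector J κ (z κ)) (hne : ∀ κ, z κ ≠ 0) :
    t.card ≤ Module.finrank ℝ V := by
  have hli : LinearIndependent ℝ fun κ : t => r (z κ) := by
    rw [Fintype.linearIndependent_iff]
    intro c hc
    set w := ∑ κ, c κ • z κ with hw
    have hrw : r w = 0 := by rw [hw, map_sum, ← hc]; simp
    have horth : ∀ κ, inner ℝ (J (z κ)) (J w) = c κ * ‖J (z κ)‖ ^ 2 := by
      intro κ
      rw [hw, map_sum, inner_sum, Finset.sum_eq_single κ]
      · rw [map_smul, real_inner_smul_right, real_inner_self_eq_norm_sq]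
      · intro κ' _ hne'
        rw [map_smul, real_inner_smul_right,
          (hz κ).inner_map_eq_zero (hz κ') (fun h => hne' (Subtype.ext h).symm), mul_zero]
      · simp
    have hwin : ∀ y, inner ℝ w y = ∑ κ, c κ * inner ℝ (z κ) y := by
      intro y
      simp_rw [hw, sum_inner, real_inner_smul_left]
    have hJin : ∀ y, inner ℝ (J w) y = ∑ κ, c κ * inner ℝ (J (z κ)) y := by
      intro y
      simp_rw [hw, map_sum, sum_inner, map_smul, real_inner_smul_left]
    have hJw : ‖J w‖ ^ 2 = ∑ κ, c κ ^ 2 * ‖J (z κ)‖ ^ 2 := by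
      rw [← real_inner_self_eq_norm_sq, hJin]
      refine Finset.sum_congr rfl fun κ _ => ?_
      rw [horth]
      ring
    have hww : ‖w‖ ^ 2 = ∑ κ : t, (κ : ℝ) * (c κ ^ 2 * ‖J (z κ)‖ ^ 2) := by
      rw [← real_inner_self_eq_norm_sq, hwin]
      refine Finset.sum_congr rfl fun κ _ => ?_
      rw [hz κ w, horth]
      ring
    have h1 := hr w hrw
    rw [hJw, hww, Finset.mul_sum, ← sub_nonneg, ← Finset.sum_sub_distrib] at h1
    have hterm : ∀ κ ∈ (Finset.univ : Finset t), (κ : ℝ) * (c κ ^ 2 * ‖J (z κ)‖ ^ 2) -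
        κ₀ * (c κ ^ 2 * ‖J (z κ)‖ ^ 2) ≤ 0 := by
      intro κ _
      have := ht κ κ.2
      have h2 : 0 ≤ c κ ^ 2 * ‖J (z κ)‖ ^ 2 := by positivity
      nlinarith
    have hzero := (Finset.sum_eq_zero_iff_of_nonpos hterm).1
      (le_antisymm (Finset.sum_nonpos hterm) h1)
    intro κ
    have h3 := hzero κ (Finset.mem_univ _)
    rw [← sub_mul] at h3
    have h4 := (mul_eq_zero.1 h3).resolve_left (sub_ne_zero.2 (ht κ κ.2).ne)
    have h5 : ‖J (z κ)‖ ^ 2 ≠ 0 := by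
      intro h5
      have h6 := (hz κ).norm_sq
      rw [h5, mul_zero] at h6
      exact hne κ (by simpa using h6)
    simpa using (mul_eq_zero.1 h4).resolve_right h5
  simpa using hli.fintype_card_le_finrank

/-- The equation `⟨z, w⟩ - κ ⟨J z, J w⟩ = ⟨f, J w⟩` is well posed for every `κ < κ₀` that is not an
eigenvalue. -/
lemma exists_weak_solution [CompleteSpace H] [CompleteSpace E] [FiniteDimensional ℝ V]
    (hcl : IsClosed (LinearMap.ker r : Set H)) (hκ₀ : 0 < κ₀)
    (hr : ∀ w, r w = 0 → κ₀ * ‖J w‖ ^ 2 ≤ ‖w‖ ^ 2) {κ : ℝ} (hκ : κ < κ₀)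
    (hinj : ∀ z, IsWeakEigenvector J κ z → z = 0) :
    ∃ C : ℝ, ∀ f : E, ∃ z : H,
      (∀ w, inner ℝ z w - κ * inner ℝ (J z) (J w) = inner ℝ f (J w)) ∧ ‖z‖ ≤ C * ‖f‖ := by
  set T : H →L[ℝ] H := 1 - κ • (ContinuousLinearMap.adjoint J ∘L J) with hTdef
  have hTin : ∀ z w, inner ℝ (T z) w = inner ℝ z w - κ * inner ℝ (J z) (J w) := by
    intro z w
    simp [hTdef, inner_sub_left, real_inner_smul_left, ContinuousLinearMap.adjoint_inner_left]
  have hT : IsSelfAdjoint T := by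
    rw [ContinuousLinearMap.isSelfAdjoint_iff_isSymmetric]
    intro z w
    change inner ℝ (T z) w = inner ℝ z (T w)
    rw [real_inner_comm (T w), hTin, hTin, real_inner_comm, real_inner_comm (J z)]
  have hquot : (LinearMap.ker r).CoFG := Submodule.CoFG.ker r
  -- The constant is `1 - κ⁺ / κ₀`.
  have hε : 0 < 1 - max κ 0 / κ₀ := by
    rw [sub_pos, div_lt_one hκ₀]
    exact max_lt hκ hκ₀
  have hco : ∀ z ∈ LinearMap.ker r, (1 - max κ 0 / κ₀) * ‖z‖ ^ 2 ≤ inner ℝ (T z) z := by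
    intro z hz
    rw [hTin, real_inner_self_eq_norm_sq, real_inner_self_eq_norm_sq]
    have h1 : ‖J z‖ ^ 2 ≤ ‖z‖ ^ 2 / κ₀ := by
      rw [le_div_iff₀ hκ₀, mul_comm]
      exact hr z hz
    have h2 : κ * ‖J z‖ ^ 2 ≤ max κ 0 * (‖z‖ ^ 2 / κ₀) :=
      (mul_le_mul_of_nonneg_right (le_max_left κ 0) (sq_nonneg _)).trans
        (mul_le_mul_of_nonneg_left h1 (le_max_right κ 0))
    have h3 : max κ 0 * (‖z‖ ^ 2 / κ₀) = max κ 0 / κ₀ * ‖z‖ ^ 2 := by ring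
    linarith
  obtain ⟨e, he⟩ := exists_equiv_of_coercive_on T hT _ hcl hε hco fun z hz => hinj z fun w => by
    have := hTin z w
    rw [hz, inner_zero_left] at this
    linarith
  refine ⟨‖(e.symm : H →L[ℝ] H) ∘L ContinuousLinearMap.adjoint J‖, fun f =>
    ⟨e.symm (ContinuousLinearMap.adjoint J f), fun w => ?_, ?_⟩⟩
  · rw [← hTin, ← he, ContinuousLinearEquiv.apply_symm_apply,
      ContinuousLinearMap.adjoint_inner_left]
  · exact ContinuousLinearMap.le_opNorm
      ((e.symm : H →L[ℝ] H) ∘L ContinuousLinearMap.adjoint J) f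

end Pencil

/-! ### The form domain as a Hilbert space -/

noncomputable section

namespace WeightedGraph

variable {X : Type*} (G : WeightedGraph X)

lemma form_self_nonneg (u : X → ℝ) : 0 ≤ G.form u u :=
  mul_nonneg (by norm_num) (tsum_nonneg fun p =>
    mul_nonneg (G.b_nonneg _ _) (mul_self_nonneg _))

/-- The weighted difference `(b(x,y) / 2)^{1/2} (u(x) - u(y))`, whose square sums up to `Q(u)`. -/
def grad (u : X → ℝ) (p : X × X) : ℝ := √(G.b p.1 p.2 / 2) * (u p.1 - u p.2)

lemma grad_mul_grad (u v : X → ℝ) (p : X × X) :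
    G.grad u p * G.grad v p =
      1 / 2 * (G.b p.1 p.2 * ((u p.1 - u p.2) * (v p.1 - v p.2))) := by
  have h := Real.mul_self_sqrt (div_nonneg (G.b_nonneg p.1 p.2) zero_le_two)
  unfold grad
  linear_combination (u p.1 - u p.2) * (v p.1 - v p.2) * h

variable [MeasurableSpace X]

/-- The graph norm equals the form norm; membership in the form domain is not needed. -/
lemma formNorm_fst {z : WithLp 2 (G.ell2 × lp (fun _ : X × X => ℝ) 2)}
    (hz : ∀ p, z.snd p = G.grad z.fst p) : G.formNorm z.fst = ‖z‖ₑ := by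
  have hsnd : ‖z.snd‖ₑ ^ 2 = G.energy z.fst := by
    have hp : (0 : ℝ) < (2 : ℝ≥0∞).toReal := by norm_num
    have h1 := lp.norm_rpow_eq_tsum hp z.snd
    have h2 := (lp.memℓp z.snd).summable hp
    simp only [ENNReal.toReal_ofNat, Real.rpow_ofNat] at h1 h2
    rw [← ofReal_norm, ← ENNReal.ofReal_pow (norm_nonneg _), h1,
      ENNReal.ofReal_tsum_of_nonneg (fun _ => sq_nonneg _) h2, energy, ← ENNReal.tsum_mul_left]
    refine tsum_congr fun p => ?_
    rw [hz, Real.norm_eq_abs, sq_abs, sq, grad_mul_grad, ENNReal.ofReal_mul (by norm_num), ← sq,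
      ENNReal.ofReal_div_of_pos two_pos]
    simp
  have h : ‖z‖ₑ ^ 2 = G.energy z.fst + ‖z.fst‖ₑ ^ 2 := by
    rw [← hsnd]
    simp_rw [← ofReal_norm, ← ENNReal.ofReal_pow (norm_nonneg _)]
    rw [← ENNReal.ofReal_add (sq_nonneg _) (sq_nonneg _), WithLp.prod_norm_sq_eq_of_L2, add_comm]
  rw [formNorm, ← h, ← ENNReal.rpow_natCast, ← ENNReal.rpow_mul]
  norm_num

variable [DiscreteMeasurableSpace X]

lemma enorm_sq_eq_tsum (u : G.ell2) :
    ‖u‖ₑ ^ 2 = ∑' x, ENNReal.ofReal (G.m x * u x ^ 2) := by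
  have h : ‖u‖ₑ ^ 2 = ∫⁻ x, ‖u x‖ₑ ^ 2 ∂G.measure := by
    rw [Lp.enorm_def, eLpNorm_eq_lintegral_rpow_enorm_toReal (by norm_num) (by norm_num),
      ← ENNReal.rpow_natCast, ← ENNReal.rpow_mul]
    norm_num
  refine h.trans ((lintegral_sum_measure _ _).trans (tsum_congr fun x => ?_))
  rw [lintegral_smul_measure, lintegral_dirac, smul_eq_mul, ENNReal.ofReal_mul (G.m_pos x).le,
    Real.enorm_eq_ofReal_abs, ← ENNReal.ofReal_pow (abs_nonneg _), sq_abs]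

/-- The indicator function of the vertex `x` in `ℓ²(X, m)`. -/
def delta (x : X) : G.ell2 :=
  indicatorConstLp 2 (MeasurableSet.of_discrete (s := {x})) (G.measure_singleton_ne_top x) (1 : ℝ)

lemma coe_delta (x : X) : (G.delta x : X → ℝ) = Set.indicator {x} fun _ => (1 : ℝ) :=
  G.eq_of_ae indicatorConstLp_coeFn

lemma delta_mem_Cc (x : X) : G.delta x ∈ G.Cc := by
  simp only [Cc, Set.mem_ofPred_eq, coe_delta]
  exact (Set.finite_singleton x).subset Set.support_indicator_subset

/-- Evaluation at the vertex `x`, as a continuous linear functional on `ℓ²(X, m)`. -/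
def evalL (x : X) : G.ell2 →L[ℝ] ℝ := (G.measure.real {x})⁻¹ • innerSL ℝ (G.delta x)

lemma evalL_apply (x : X) (u : G.ell2) : G.evalL x u = u x := by
  have hpos : G.measure.real {x} ≠ 0 :=
    ENNReal.toReal_ne_zero.2 ⟨G.measure_singleton_ne_zero x, G.measure_singleton_ne_top x⟩
  change (G.measure.real {x})⁻¹ * inner ℝ (G.delta x) u = u x
  rw [delta, L2.inner_indicatorConstLp_one, integral_singleton, smul_eq_mul,
    inv_mul_cancel_left₀ hpos]

/-- The form domain `D` with the inner product `⟨u, v⟩ + Q(u, v)`, realized as the graph of the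
weighted difference operator in `ℓ²(X, m) × ℓ²(X × X)`. -/
def formSpace : Submodule ℝ (WithLp 2 (G.ell2 × lp (fun _ : X × X => ℝ) 2)) where
  carrier := {z | z.fst ∈ G.formDomain ∧ ∀ p, z.snd p = G.grad z.fst p}
  zero_mem' := by
    refine ⟨zero_mem _, fun p => ?_⟩
    rw [WithLp.zero_fst, WithLp.zero_snd, coe_zero]
    simp [grad]
  add_mem' := by
    rintro z w ⟨hz, hz'⟩ ⟨hw, hw'⟩
    refine ⟨add_mem hz hw, fun p => ?_⟩
    rw [WithLp.add_fst, WithLp.add_snd, coe_add, lp.coeFn_add, Pi.add_apply, hz', hw']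
    simp only [grad, Pi.add_apply]
    ring
  smul_mem' := by
    rintro c z ⟨hz, hz'⟩
    refine ⟨Submodule.smul_mem _ c hz, fun p => ?_⟩
    rw [WithLp.smul_fst, WithLp.smul_snd, coe_smul, lp.coeFn_smul, Pi.smul_apply, hz']
    simp only [grad, Pi.smul_apply, smul_eq_mul]
    ring

/-- The inclusion of the form domain into `ℓ²(X, m)`. -/
def incl : G.formSpace →L[ℝ] G.ell2 := WithLp.fstL 2 ℝ _ _ ∘L G.formSpace.subtypeL

lemma incl_mem (z : G.formSpace) : G.incl z ∈ G.formDomain := z.2.1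

lemma incl_injective : Function.Injective G.incl := by
  rintro ⟨z, hz⟩ ⟨w, hw⟩ h
  have h : z.fst = w.fst := h
  refine Subtype.ext ?_
  have h2 : z.snd = w.snd := by
    ext p
    rw [hz.2, hw.2, h]
  exact WithLp.ofLp_injective 2 (Prod.ext h h2)

lemma exists_incl_eq {u : G.ell2} (hu : u ∈ G.formDomain) : ∃ z, G.incl z = u := by
  have hmem : Memℓp (G.grad u) 2 := by
    refine memℓp_gen (((G.summable_sq_of_mem hu).mul_left (1 / 2)).congr fun p => ?_)
    have h := G.grad_mul_grad u u p
    rw [Real.norm_eq_abs, ENNReal.toReal_ofNat, Real.rpow_ofNat, sq_abs, sq (G.grad u p), h, sq]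
  exact ⟨⟨WithLp.toLp 2 (u, ⟨G.grad u, hmem⟩), hu, fun p => rfl⟩, rfl⟩

lemma formSpace_inner (z w : G.formSpace) :
    inner ℝ z w = inner ℝ (G.incl z) (G.incl w) + G.form (G.incl z) (G.incl w) := by
  rw [Submodule.coe_inner, WithLp.prod_inner_apply]
  congr 1
  rw [lp.inner_eq_tsum, form, ← tsum_mul_left]
  refine tsum_congr fun p => ?_
  rw [← grad_mul_grad]
  have hz : (z : WithLp 2 (G.ell2 × lp (fun _ : X × X => ℝ) 2)).ofLp.2 p = G.grad (G.incl z) p :=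
    z.2.2 p
  have hw : (w : WithLp 2 (G.ell2 × lp (fun _ : X × X => ℝ) 2)).ofLp.2 p = G.grad (G.incl w) p :=
    w.2.2 p
  rw [hz, hw]
  exact mul_comm _ _

lemma energy_eq_ofReal_form {u : G.ell2} (hu : u ∈ G.formDomain) :
    G.energy u = ENNReal.ofReal (G.form u u) := by
  have hn : ∀ p : X × X, 0 ≤ G.b p.1 p.2 * (u p.1 - u p.2) ^ 2 :=
    fun p => mul_nonneg (G.b_nonneg _ _) (sq_nonneg _)
  have hf : G.form u u = 1 / 2 * ∑' p : X × X, G.b p.1 p.2 * (u p.1 - u p.2) ^ 2 := by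
    simp only [form, sq]
  rw [energy, ← ENNReal.ofReal_tsum_of_nonneg hn (G.summable_sq_of_mem hu), hf,
    ENNReal.ofReal_mul (by norm_num)]
  congr 1
  rw [ENNReal.ofReal_div_of_pos two_pos]
  simp

lemma formSpace_norm_sq (z : G.formSpace) :
    ‖z‖ ^ 2 = ‖G.incl z‖ ^ 2 + G.form (G.incl z) (G.incl z) := by
  rw [← real_inner_self_eq_norm_sq, ← real_inner_self_eq_norm_sq, formSpace_inner]

lemma formNorm_incl (z : G.formSpace) : G.formNorm (G.incl z) = ‖z‖ₑ := G.formNorm_fst z.2.2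

lemma dense_Cc : Dense {z : G.formSpace | G.incl z ∈ G.Cc} := by
  intro z
  rw [EMetric.mem_closure_iff]
  intro ε hε
  obtain ⟨φ, hφ, h⟩ := G.incl_mem z ε hε
  obtain ⟨w, rfl⟩ := G.exists_incl_eq (G.Cc_subset_formDomain hφ)
  refine ⟨w, hφ, ?_⟩
  rwa [edist_eq_enorm_sub, ← formNorm_incl, map_sub]

/-- The form is closed: norm limits in the graph keep `z.snd = grad z.fst`, as point evaluations are
continuous, and limits in the form norm of elements of the closure of `C_c(X)` stay in it. -/
lemma isClosed_formSpace :
    IsClosed (G.formSpace : Set (WithLp 2 (G.ell2 × lp (fun _ : X × X => ℝ) 2))) := by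
  refine isClosed_of_closure_subset fun z hz => ?_
  have hgrad : ∀ p, z.snd p = G.grad z.fst p := by
    intro p
    have hc : IsClosed {w : WithLp 2 (G.ell2 × lp (fun _ : X × X => ℝ) 2) |
        w.snd p = √(G.b p.1 p.2 / 2) * (G.evalL p.1 w.fst - G.evalL p.2 w.fst)} := by
      refine isClosed_eq ?_ ?_
      · exact ((lp.evalCLM ℝ (fun _ : X × X => ℝ) 2 p) ∘L (WithLp.sndL 2 ℝ _ _)).continuous
      · exact continuous_const.mul (((G.evalL p.1 - G.evalL p.2) ∘L
          (WithLp.fstL 2 ℝ _ _)).continuous)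
    have h := closure_minimal (fun w (hw : w ∈ G.formSpace) => by
      simp only [Set.mem_ofPred_eq, evalL_apply]
      exact hw.2 p) hc hz
    simp only [Set.mem_ofPred_eq, evalL_apply] at h
    exact h
  refine ⟨fun ε hε => ?_, hgrad⟩
  obtain ⟨w, hw, hzw⟩ := EMetric.mem_closure_iff.1 hz (ε / 2) (ENNReal.half_pos hε.ne')
  obtain ⟨v, hwv, hv⟩ := EMetric.dense_iff.1 G.dense_Cc ⟨w, hw⟩ (ε / 2) (ENNReal.half_pos hε.ne')
  refine ⟨G.incl v, hv, ?_⟩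
  have h1 : ∀ p, (z - (v : WithLp 2 (G.ell2 × lp (fun _ : X × X => ℝ) 2))).snd p =
      G.grad (z - (v : WithLp 2 (G.ell2 × lp (fun _ : X × X => ℝ) 2))).fst p := by
    intro p
    rw [WithLp.sub_fst, WithLp.sub_snd, coe_sub, lp.coeFn_sub, Pi.sub_apply, hgrad, v.2.2]
    simp only [grad, Pi.sub_apply]
    ring
  have h2 := G.formNorm_fst h1
  rw [WithLp.sub_fst] at h2
  change G.formNorm (z.fst - (v : WithLp 2 (G.ell2 × lp (fun _ : X × X => ℝ) 2)).fst) < ε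
  rw [h2, ← edist_eq_enorm_sub]
  calc edist z v ≤ edist z w + edist w v := edist_triangle _ _ _
    _ < ε / 2 + ε / 2 := ENNReal.add_lt_add hzw (by rw [edist_comm]; exact hwv)
    _ = ε := ENNReal.add_halves ε

instance : CompleteSpace G.formSpace := G.isClosed_formSpace.completeSpace_coe

/-- Cheeger's inequality on the part of the form domain that vanishes on `K`. By density, it is
enough to have it for finitely supported functions: the projection `z ↦ 1_{X ∖ K} z` is continuous
in the form norm and preserves finiteness of the support. -/
lemma one_add_mul_norm_sq_le [Countable X] [PseudoMetricSpace X] (hd : G.IsIntrinsic)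
    {K : Finset X} {a : ℝ} (ha : 0 ≤ a) (haK : ENNReal.ofReal a ≤ G.cheeger (K : Set X)ᶜ)
    (z : G.formSpace) (hz : ∀ x ∈ K, G.incl z x = 0) :
    (1 + a ^ 2 / 2) * ‖G.incl z‖ ^ 2 ≤ ‖z‖ ^ 2 := by
  classical
  choose δ hδ using fun x => G.exists_incl_eq (G.Cc_subset_formDomain (G.delta_mem_Cc x))
  set P : G.formSpace →L[ℝ] G.formSpace :=
    1 - ∑ x ∈ K, (G.evalL x ∘L G.incl).smulRight (δ x) with hP
  have hPz : ∀ w, P w = w - ∑ x ∈ K, G.incl w x • δ x := by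
    intro w
    simp [hP, evalL_apply]
  have hPe : ∀ w y, G.incl (P w) y = if y ∈ K then 0 else G.incl w y := by
    intro w y
    rw [hPz, ← evalL_apply, map_sub, map_sub, map_sum, map_sum, evalL_apply]
    have h : ∀ x ∈ K, G.evalL y (G.incl (G.incl w x • δ x)) = if x = y then G.incl w y else 0 := by
      intro x _
      rw [map_smul, map_smul, hδ, evalL_apply, coe_delta, smul_eq_mul, Set.indicator_apply]
      by_cases h : x = y
      · simp [h]
      · simp [h, Ne.symm h]
    rw [Finset.sum_congr rfl h, Finset.sum_ite_eq']
    split_ifs <;> simp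
  have hclosed : IsClosed {w : G.formSpace | (1 + a ^ 2 / 2) * ‖G.incl (P w)‖ ^ 2 ≤ ‖P w‖ ^ 2} :=
    isClosed_le (continuous_const.mul ((G.incl ∘L P).continuous.norm.pow 2))
      (P.continuous.norm.pow 2)
  have hsub : {w : G.formSpace | G.incl w ∈ G.Cc} ⊆
      {w : G.formSpace | (1 + a ^ 2 / 2) * ‖G.incl (P w)‖ ^ 2 ≤ ‖P w‖ ^ 2} := by
    intro w hw
    have hfin : (Function.support (G.incl (P w) : X → ℝ)).Finite := by
      refine Set.Finite.subset (s := Function.support (G.incl w : X → ℝ)) hw fun y hy => ?_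
      rw [Function.mem_support, hPe] at hy
      split_ifs at hy with h
      · exact absurd rfl hy
      · exact hy
    have hU : Function.support (G.incl (P w) : X → ℝ) ⊆ (K : Set X)ᶜ := by
      intro y hy hyK
      rw [Function.mem_support, hPe, if_pos (by simpa using hyK)] at hy
      exact hy rfl
    have h := G.mul_tsum_sq_le_energy hd ha haK hfin hU
    rw [← G.enorm_sq_eq_tsum, G.energy_eq_ofReal_form (G.incl_mem _), ← ofReal_norm,
      ← ENNReal.ofReal_pow (norm_nonneg _), ← ENNReal.ofReal_mul (by positivity),
      ENNReal.ofReal_le_ofReal_iff (G.form_self_nonneg _)] at h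
    simp only [Set.mem_ofPred_eq]
    rw [formSpace_norm_sq]
    linarith
  have hall := hclosed.closure_subset_iff.2 hsub (G.dense_Cc z)
  have hPzz : P z = z := by
    rw [hPz, Finset.sum_eq_zero fun x hx => by rw [hz x hx, zero_smul], sub_zero]
  simpa only [Set.mem_ofPred_eq, hPzz] using hall

/-! ### The spectrum of the Laplacian below the isoperimetric bound -/

/-- The weak form of `L u - ν u`, tested against the form domain. The shift from `ν` to `1 + ν`
comes from the `ℓ²` term in the inner product of `formSpace`. -/
lemma inner_subScalar (ν : ℝ) (u : G.laplacian.domain) {z : G.formSpace} (hz : G.incl z = u)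
    (w : G.formSpace) :
    inner ℝ z w - (1 + ν) * inner ℝ (G.incl z) (G.incl w) =
      inner ℝ (G.laplacian.subScalar ν u) (G.incl w) := by
  have h : ((u : G.ell2), G.laplacian u) ∈ G.laplacianGraph :=
    G.graph_laplacian ▸ G.laplacian.mem_graph u
  have h1 : G.form (G.incl z) (G.incl w) = inner ℝ (G.laplacian u) (G.incl w) :=
    hz ▸ h.2 _ (G.incl_mem w)
  change _ = inner ℝ (G.laplacian u - ν • (u : G.ell2)) (G.incl w)
  rw [formSpace_inner, h1, ← hz, inner_sub_left, real_inner_smul_left]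
  ring

/-- Weak solutions are in the domain of `L`: this is the definition of the operator associated with
the form. -/
lemma exists_subScalar_eq {ν : ℝ} {f : G.ell2} {z : G.formSpace}
    (h : ∀ w, inner ℝ z w - (1 + ν) * inner ℝ (G.incl z) (G.incl w) = inner ℝ f (G.incl w)) :
    ∃ u : G.laplacian.domain, (u : G.ell2) = G.incl z ∧ G.laplacian.subScalar ν u = f := by
  have hmem : (G.incl z, f + ν • G.incl z) ∈ G.laplacian.graph := by
    rw [graph_laplacian]
    refine ⟨G.incl_mem z, fun v hv => ?_⟩
    obtain ⟨w, rfl⟩ := G.exists_incl_eq hv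
    have h1 := h w
    rw [formSpace_inner] at h1
    rw [inner_add_left, real_inner_smul_left]
    linarith
  obtain ⟨u, hu, hLu⟩ := (LinearPMap.mem_graph_iff _).1 hmem
  refine ⟨u, hu, ?_⟩
  change G.laplacian u - ν • (u : G.ell2) = f
  simp only at hu hLu
  rw [hLu, hu, add_sub_cancel_right]

lemma exists_incl_eq_of_domain (u : G.laplacian.domain) : ∃ z : G.formSpace, G.incl z = u := by
  have h : ((u : G.ell2), G.laplacian u) ∈ G.laplacianGraph :=
    G.graph_laplacian ▸ G.laplacian.mem_graph u
  exact G.exists_incl_eq h.1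

lemma isWeakEigenvector_of_subScalar_eq_zero {ν : ℝ} {u : G.laplacian.domain}
    (hu : G.laplacian.subScalar ν u = 0) {z : G.formSpace} (hz : G.incl z = u) :
    IsWeakEigenvector G.incl (1 + ν) z := by
  intro w
  have h := G.inner_subScalar ν u hz w
  rw [hu, inner_zero_left] at h
  linarith

/-- Restriction to the finite set `K`; its kernel has finite codimension in the form domain. -/
def restrictL (K : Finset X) : G.formSpace →L[ℝ] (K → ℝ) :=
  ContinuousLinearMap.pi fun x => G.evalL x ∘L G.incl

lemma restrictL_apply (K : Finset X) (z : G.formSpace) (x : K) :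
    G.restrictL K z x = G.incl z x := G.evalL_apply x _

section Threshold

variable {K : Finset X} {Λ : ℝ}

/-- Below `Λ`, a point of the spectrum is an eigenvalue. -/
lemma exists_weakEigenvector_of_mem_realSpectrum (hΛ : 0 ≤ Λ)
    (hK : ∀ z, (G.restrictL K : G.formSpace →ₗ[ℝ] (K → ℝ)) z = 0 →
      (1 + Λ) * ‖G.incl z‖ ^ 2 ≤ ‖z‖ ^ 2)
    {ν : ℝ} (hν : ν < Λ) (hmem : ν ∈ G.laplacian.realSpectrum) :
    ∃ z, z ≠ 0 ∧ IsWeakEigenvector G.incl (1 + ν) z := by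
  by_contra! hcon
  refine hmem ?_
  obtain ⟨C, hC⟩ := exists_weak_solution (κ := 1 + ν) (G.restrictL K).isClosed_ker
    (by positivity) hK (by linarith) fun z hz => by_contra fun h => hcon z h hz
  have hinj : Function.Injective (G.laplacian.subScalar ν) := by
    rw [← LinearMap.ker_eq_bot, Submodule.eq_bot_iff]
    intro u hu
    obtain ⟨z, hz⟩ := G.exists_incl_eq_of_domain u
    have h0 : z = 0 := by_contra fun h =>
      hcon z h (G.isWeakEigenvector_of_subScalar_eq_zero hu hz)
    refine Subtype.ext ?_
    rw [← hz, h0, map_zero, Submodule.coe_zero]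
  have hsol : ∀ f : G.ell2, ∃ u, G.laplacian.subScalar ν u = f ∧ ‖u‖ ≤ ‖G.incl‖ * C * ‖f‖ := by
    intro f
    obtain ⟨z, hz, hzC⟩ := hC f
    obtain ⟨u, hu, huf⟩ := G.exists_subScalar_eq hz
    refine ⟨u, huf, ?_⟩
    rw [Submodule.coe_norm, hu, mul_assoc]
    exact (G.incl.le_opNorm z).trans (mul_le_mul_of_nonneg_left hzC (norm_nonneg G.incl))
  refine ⟨⟨hinj, fun f => (hsol f).imp fun _ h => h.1⟩, ‖G.incl‖ * C, fun u => ?_⟩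
  obtain ⟨u', hu', hC'⟩ := hsol (G.laplacian.subScalar ν u)
  rwa [hinj hu'] at hC'

lemma finite_realSpectrum_inter_Iio (hΛ : 0 ≤ Λ)
    (hK : ∀ z, (G.restrictL K : G.formSpace →ₗ[ℝ] (K → ℝ)) z = 0 →
      (1 + Λ) * ‖G.incl z‖ ^ 2 ≤ ‖z‖ ^ 2) :
    (G.laplacian.realSpectrum ∩ Set.Iio Λ).Finite := by
  by_contra hinf
  have hinf' : ((1 + ·) '' (G.laplacian.realSpectrum ∩ Set.Iio Λ)).Infinite :=
    Set.Infinite.image (add_right_injective (1 : ℝ)).injOn hinf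
  obtain ⟨t, ht, hcard⟩ := hinf'.exists_subset_card_eq (Module.finrank ℝ (K → ℝ) + 1)
  have hex : ∀ κ : t, κ < 1 + Λ ∧ ∃ z, z ≠ 0 ∧ IsWeakEigenvector G.incl κ z := by
    intro κ
    obtain ⟨ν, ⟨hν, hνΛ⟩, hκ⟩ := ht κ.2
    rw [← hκ]
    exact ⟨add_lt_add_right hνΛ 1,
      G.exists_weakEigenvector_of_mem_realSpectrum hΛ hK hνΛ hν⟩
  choose hlt z hz0 hz using hex
  have := card_le_finrank_of_isWeakEigenvector hK t (fun κ hκ => hlt ⟨κ, hκ⟩) z hz hz0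
  omega

lemma mem_discreteSpectrum (hΛ : 0 ≤ Λ)
    (hK : ∀ z, (G.restrictL K : G.formSpace →ₗ[ℝ] (K → ℝ)) z = 0 →
      (1 + Λ) * ‖G.incl z‖ ^ 2 ≤ ‖z‖ ^ 2)
    {ν : ℝ} (hν : ν < Λ) (hmem : ν ∈ G.laplacian.realSpectrum) :
    ν ∈ G.laplacian.discreteSpectrum := by
  refine ⟨hmem, ?_, ?_, ?_⟩
  · have hcl : IsClosed ((G.laplacian.realSpectrum ∩ Set.Iio Λ) \ {ν}) :=
      (G.finite_realSpectrum_inter_Iio hΛ hK).sdiff.isClosed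
    have hopen : IsOpen (((G.laplacian.realSpectrum ∩ Set.Iio Λ) \ {ν})ᶜ ∩ Set.Iio Λ) :=
      hcl.isOpen_compl.inter isOpen_Iio
    obtain ⟨ε, hε, hball⟩ := Metric.isOpen_iff.1 hopen ν ⟨fun h => h.2 rfl, hν⟩
    refine ⟨ε, hε, fun μ hμ hμν => ?_⟩
    have h := hball (show μ ∈ Metric.ball ν ε from hμν)
    by_contra hne
    exact h.1 ⟨⟨hμ, h.2⟩, hne⟩
  · obtain ⟨z, hz0, hz⟩ := G.exists_weakEigenvector_of_mem_realSpectrum hΛ hK hν hmem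
    obtain ⟨u, hu, hu0⟩ := G.exists_subScalar_eq (ν := ν) (f := 0) (z := z) fun w => by
      rw [hz w, inner_zero_left, sub_self]
    refine (Submodule.ne_bot_iff _).2 ⟨u, hu0, fun h => hz0 (G.incl_injective ?_)⟩
    rw [← hu, h, map_zero, Submodule.coe_zero]
  · have hval : ∀ u : G.laplacian.domain, G.laplacian.subScalar ν u = 0 →
        (∀ x ∈ K, (u : G.ell2) x = 0) → u = 0 := by
      intro u hu hx
      obtain ⟨z, hz⟩ := G.exists_incl_eq_of_domain u
      have h0 := (G.isWeakEigenvector_of_subScalar_eq_zero hu hz).eq_zero_of_map_eq_zero hK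
        (by linarith) (funext fun x => by
          change G.restrictL K z x = 0
          rw [restrictL_apply, hz, hx x x.2])
      refine Subtype.ext ?_
      rw [← hz, h0, map_zero, Submodule.coe_zero]
    let ρ : LinearMap.ker (G.laplacian.subScalar ν) →ₗ[ℝ] (K → ℝ) :=
      LinearMap.pi fun x => (G.evalL x : G.ell2 →ₗ[ℝ] ℝ) ∘ₗ G.laplacian.domain.subtype ∘ₗ
        (LinearMap.ker (G.laplacian.subScalar ν)).subtype
    refine FiniteDimensional.of_injective ρ (LinearMap.ker_eq_bot.1 ?_)
    rw [Submodule.eq_bot_iff]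
    intro u hu
    refine Subtype.ext (hval u.1 u.2 fun x hx => ?_)
    have h : G.evalL x (u.1 : G.ell2) = 0 := congrFun hu ⟨x, hx⟩
    rwa [evalL_apply] at h

end Threshold

end WeightedGraph

end

theorem mainTheorem2 {X : Type*} [Countable X] [Infinite X]
    [MeasurableSpace X] [DiscreteMeasurableSpace X] [PseudoMetricSpace X]
    (G : WeightedGraph X) (hd : G.IsIntrinsic)
    (hL : G.Cc ⊆ G.laplacian.domain) :
    ((G.cheegerInfty ^ 2 / 2 : ENNReal) : EReal) ≤ G.laplacian.bottomEssentialSpectrum := by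
  refine le_iInf₂ fun μ hμ => ?_
  have key : ∀ (K : Finset X) (a : ℝ), 0 ≤ a → ENNReal.ofReal a ≤ G.cheeger (K : Set X)ᶜ →
      a ^ 2 / 2 ≤ μ := by
    intro K a ha haK
    by_contra! hlt
    refine hμ.2 (G.mem_discreteSpectrum (K := K) (by positivity) (fun z hz => ?_) hlt hμ.1)
    refine G.one_add_mul_norm_sq_le hd ha haK z fun x hx => ?_
    rw [← G.restrictL_apply K z ⟨x, hx⟩]
    exact congrFun hz ⟨x, hx⟩
  -- The case `a = 0` of the bound gives the sign of `μ`.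
  have hμ0 : 0 ≤ μ := by simpa using key ∅ 0 le_rfl (by simp)
  -- In particular `α_∞ < ∞` as soon as the essential spectrum has a point `μ`.
  have hle : G.cheegerInfty ≤ ENNReal.ofReal √(2 * μ) := by
    refine iSup_le fun K => le_of_forall_lt_imp_le_of_dense fun c hc => ?_
    rw [← ENNReal.ofReal_toReal hc.ne_top]
    refine ENNReal.ofReal_le_ofReal (Real.le_sqrt_of_sq_le ?_)
    have h := key K c.toReal ENNReal.toReal_nonneg
      (by rw [ENNReal.ofReal_toReal hc.ne_top]; exact hc.le)
    linarith
  have hfin : G.cheegerInfty ^ 2 / 2 ≤ ENNReal.ofReal μ := by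
    calc G.cheegerInfty ^ 2 / 2 ≤ ENNReal.ofReal √(2 * μ) ^ 2 / 2 := by gcongr
      _ = ENNReal.ofReal μ := by
        rw [← ENNReal.ofReal_pow (Real.sqrt_nonneg _), Real.sq_sqrt (by positivity),
          ← ENNReal.ofReal_ofNat 2, ← ENNReal.ofReal_div_of_pos two_pos]
        congr 1
        ring
  calc ((G.cheegerInfty ^ 2 / 2 : ENNReal) : EReal) ≤ (ENNReal.ofReal μ : EReal) :=
        EReal.coe_ennreal_le_coe_ennreal_iff.2 hfin
    _ = μ := by rw [EReal.coe_ennreal_ofReal, max_eq_left hμ0]
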